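/- **Theorem 1.4.** Let $G$ be a discrete group with identity element $e$, and let $\mathbb L : G \to [0,\infty)$ be a length function, that is, $\mathbb L(xy)\le \mathbb L(x)+\mathbb L(y)$ and $\mathbb L(x^{-1})=\mathbb L(x)$ for all $x,y\in G$, and $\mathbb L(x)=0$ if and only if $x=e$. Put $B(r)=\{x\in G:\mathbb L(x)\le r\}$ and assume that $\mathbb L$ has bounded doubling: $B(r)$ is finite for every $r<\infty$, and there is a constant $C<\infty$ such that $|B(2r)|\le C\,|B(r)|$ for all $r\ge 1$. Let $c_c=C_c(G)$ be the convolution $*$-algebra of finitely supported functions $f:G\to\mathbb C$, with $f^*(x)=\overline{f(x^{-1})}$, let $\lambda_f$ be the operator $(\lambda_f\xi)(x)=\sum_{y\in G} f(xy^{-1})\xi(y)$ on $\ell^2(G)$, and let $D=M_{\mathbb L}$ be the (in general unbounded) operator of pointwise multiplication by $\mathbb L$ on $\ell^2(G)$, with its maximal domain. For every $f\in c_c$ the commutator $[D,\lambda_f]$ extends to a bounded operator on $\ell^2(G)$; put $L_D(f)=\|[D,\lambda_f]\|$ (operator norm). Then $L_D$ is a Lip-norm on $C^*(G)$. This holds both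 for the reduced group C*-algebra $C^*_r(G)$, the operator-norm closure of $\{\lambda_f : f\in c_c\}$, and for the full group C*-algebra $C^*(G)$, the norm closure of $c_c$ in the universal unitary representation of $G$. Explicitly, if $\bar A$ is either of these unital C*-algebras, then $c_c$ embeds in $\bar A$ as a dense $*$-subalgebra; $L_D$ is a seminorm on $c_c$ with $L_D(f^*)=L_D(f)$ and $L_D(1)=0$; and the topology on the state space $S(\bar A)$ defined by the metric $$\rho_{L_D}(\mu,\nu)=\sup\{|\mu(f)-\nu(f)| : f\in c_c,\ L_D(f)\le 1\}$$ (which a priori takes values in $[0,\infty]$) coincides with the weak-$*$ topology. -/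

import Mathlib

open scoped MonoidAlgebra ENNReal ComplexOrder

noncomputable section

namespace GroupCStar

universe u v w

/-! ### Length functions and growth -/

/-- A length function on a group. -/
structure LengthFunction (G : Type u) [Group G] where
  toFun : G → ℝ
  nonneg' : ∀ x, 0 ≤ toFun x
  mul_le' : ∀ x y, toFun (x * y) ≤ toFun x + toFun y
  inv' : ∀ x, toFun x⁻¹ = toFun x
  eq_zero_iff' : ∀ x, toFun x = 0 ↔ x = 1

instance {G : Type u} [Group G] : CoeFun (LengthFunction G) (fun _ => G → ℝ) :=
  ⟨LengthFunction.toFun⟩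

namespace LengthFunction

variable {G : Type u} [Group G] (𝕃 : LengthFunction G)

/-- The closed ball `B(r)` about the identity element. -/
def ball (r : ℝ) : Set G := {x | 𝕃 x ≤ r}

/-- Every ball is a finite set. -/
def IsProper : Prop := ∀ r : ℝ, (𝕃.ball r).Finite

/-- `𝕃` is proper and `|B(2r)| ≤ C |B(r)|` for all `r ≥ 1`. -/
def BoundedDoubling : Prop :=
  𝕃.IsProper ∧ ∃ C : ℝ, ∀ r : ℝ, 1 ≤ r →
    ((𝕃.ball (2 * r)).ncard : ℝ) ≤ C * ((𝕃.ball r).ncard : ℝ)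

theorem abs_sub_le (g x : G) : |𝕃 (g * x) - 𝕃 x| ≤ 𝕃 g := by
  have h1 := 𝕃.mul_le' g x
  have h2 := 𝕃.mul_le' g⁻¹ (g * x)
  rw [inv_mul_cancel_left, 𝕃.inv'] at h2
  rw [abs_le]
  constructor <;> linarith

end LengthFunction

/-! ### The convolution `*`-algebra `c_c(G)`

`ℂ[G]` is the space of finitely supported functions on `G` with convolution; the involution is
`f*(x) = conj (f (x⁻¹))`. -/

section Star

variable {G : Type u} [Group G]

instance : Star ℂ[G] where
  star f := .ofCoeff ((f.coeff.mapRange star (star_zero ℂ)).equivMapDomain (Equiv.inv G))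

theorem coeff_star (f : ℂ[G]) (x : G) : (star f).coeff x = star (f.coeff x⁻¹) := rfl

theorem star_add_aux (f g : ℂ[G]) : star (f + g) = star f + star g := by
  ext x
  simp [coeff_star]

theorem star_single (x : G) (c : ℂ) :
    star (MonoidAlgebra.single x c) = MonoidAlgebra.single x⁻¹ (star c) := by
  ext y
  classical
  have : x = y⁻¹ ↔ x⁻¹ = y := by constructor <;> (rintro rfl; simp)
  simp only [coeff_star, MonoidAlgebra.coeff_single, Finsupp.single_apply, this]
  split_ifs <;> simp

instance : StarRing ℂ[G] where
  star_involutive f := by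
    ext x
    simp [coeff_star]
  star_add := star_add_aux
  star_mul f g := by
    induction f using MonoidAlgebra.induction_linear with
    | zero =>
      have h0 : star (0 : ℂ[G]) = 0 := by ext x; simp [coeff_star]
      simp [h0]
    | add f₁ f₂ h₁ h₂ => rw [add_mul, star_add_aux, h₁, h₂, star_add_aux, mul_add]
    | single x a =>
      induction g using MonoidAlgebra.induction_linear with
      | zero =>
        have h0 : star (0 : ℂ[G]) = 0 := by ext x; simp [coeff_star]
        simp [h0]
      | add f₁ f₂ h₁ h₂ => rw [mul_add, star_add_aux, h₁, h₂, star_add_aux, add_mul]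
      | single y b =>
        simp [star_single, MonoidAlgebra.single_mul_single, mul_comm]

instance : StarModule ℂ ℂ[G] where
  star_smul c f := by
    ext x
    simp [coeff_star]

end Star

/-! ### Group C*-algebras -/

section Representation

variable {G : Type u} [Group G]
variable {H : Type v} [NormedAddCommGroup H] [InnerProductSpace ℂ H] [CompleteSpace H]

/-- The `*`-representation `f ↦ ∑ f(x) π(x)` of `c_c(G)` integrating a unitary representation
`π` of `G` on a Hilbert space. -/
def integrate (π : G →* (H ≃ₗᵢ[ℂ] H)) : ℂ[G] →⋆ₐ[ℂ] (H →L[ℂ] H) where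
  __ := MonoidAlgebra.lift ℂ (H →L[ℂ] H) G
    ((unitary (H →L[ℂ] H)).subtype.comp
      ((Unitary.linearIsometryEquiv (𝕜 := ℂ) (H := H)).symm.toMonoidHom.comp π))
  map_star' f := by
    induction f using MonoidAlgebra.induction_linear with
    | zero => simp
    | add f g hf hg =>
      simp only [AlgHom.toRingHom_eq_coe, RingHom.toMonoidHom_eq_coe, OneHom.toFun_eq_coe,
        MonoidHom.toOneHom_coe, MonoidHom.coe_coe, RingHom.coe_coe] at hf hg ⊢
      rw [star_add, map_add, map_add, star_add, hf, hg]
    | single x a =>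
      simp only [AlgHom.toRingHom_eq_coe, RingHom.toMonoidHom_eq_coe, OneHom.toFun_eq_coe,
        MonoidHom.toOneHom_coe, MonoidHom.coe_coe, RingHom.coe_coe]
      rw [star_single, MonoidAlgebra.lift_single, MonoidAlgebra.lift_single, star_smul]
      congr 1
      simp only [MonoidHom.comp_apply, map_inv]
      rfl

theorem integrate_single (π : G →* (H ≃ₗᵢ[ℂ] H)) (g : G) (c : ℂ) (ξ : H) :
    integrate π (.single g c) ξ = c • π g ξ := by
  change (MonoidAlgebra.lift ℂ (H →L[ℂ] H) G _ (.single g c)) ξ = _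
  rw [MonoidAlgebra.lift_single]
  rfl

/-- The C*-algebra generated by a unitary representation: the operator-norm closure of the image
of `c_c(G)`. -/
def cstarOf (π : G →* (H ≃ₗᵢ[ℂ] H)) : StarSubalgebra ℂ (H →L[ℂ] H) :=
  (integrate π).range.topologicalClosure

instance (π : G →* (H ≃ₗᵢ[ℂ] H)) : IsClosed (cstarOf π : Set (H →L[ℂ] H)) :=
  StarSubalgebra.isClosed_topologicalClosure _

/-- The canonical `*`-homomorphism from `c_c(G)` to the C*-algebra generated by `π`. -/
def toCstarOf (π : G →* (H ≃ₗᵢ[ℂ] H)) : ℂ[G] →⋆ₐ[ℂ] cstarOf π :=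
  (integrate π).codRestrict (cstarOf π) fun f =>
    StarSubalgebra.le_topologicalClosure _ ⟨f, rfl⟩

end Representation

/-! ### The reduced group C*-algebra -/

section Reduced

/-- The Hilbert space `ℓ²(G)`. -/
abbrev Ell2 (G : Type u) : Type u := lp (fun _ : G => ℂ) 2

variable {G : Type u} [Group G]

theorem memℓp_translate (g : G) (ξ : Ell2 G) : Memℓp (fun x => ξ (g⁻¹ * x)) 2 := by
  have h2 : 0 < (2 : ℝ≥0∞).toReal := by simp
  refine memℓp_gen ?_
  exact (Equiv.mulLeft g⁻¹).summable_iff.mpr (ξ.2.summable h2)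

/-- Left translation `(λ_g ξ)(x) = ξ(g⁻¹ x)` on `ℓ²(G)`. -/
def leftTranslate (g : G) : Ell2 G ≃ₗᵢ[ℂ] Ell2 G where
  toFun ξ := ⟨fun x => ξ (g⁻¹ * x), memℓp_translate g ξ⟩
  invFun ξ := ⟨fun x => ξ (g⁻¹⁻¹ * x), memℓp_translate g⁻¹ ξ⟩
  map_add' _ _ := rfl
  map_smul' _ _ := rfl
  left_inv ξ := by ext x; simp
  right_inv ξ := by ext x; simp
  norm_map' ξ := by
    have h2 : 0 < (2 : ℝ≥0∞).toReal := by simp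
    rw [lp.norm_eq_tsum_rpow h2, lp.norm_eq_tsum_rpow h2]
    congr 1
    exact (Equiv.mulLeft g⁻¹).tsum_eq (fun x => ‖ξ x‖ ^ (2 : ℝ≥0∞).toReal)

@[simp]
theorem leftTranslate_apply (g : G) (ξ : Ell2 G) (x : G) :
    leftTranslate g ξ x = ξ (g⁻¹ * x) := rfl

variable (G) in
/-- The left regular representation of `G` on `ℓ²(G)`. -/
def leftRegular : G →* (Ell2 G ≃ₗᵢ[ℂ] Ell2 G) where
  toFun := leftTranslate
  map_one' := by ext ξ x; simp
  map_mul' g h := by ext ξ x; simp [mul_assoc]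

/-- `λ_f`, the operator on `ℓ²(G)` of left convolution by `f ∈ c_c(G)`. -/
abbrev lconv (f : ℂ[G]) : Ell2 G →L[ℂ] Ell2 G := integrate (leftRegular G) f

theorem lconv_apply (f : ℂ[G]) (ξ : Ell2 G) (x : G) :
    lconv f ξ x = f.coeff.sum fun y c => c * ξ (y⁻¹ * x) := by
  induction f using MonoidAlgebra.induction_linear with
  | zero => simp
  | add f g hf hg =>
    rw [MonoidAlgebra.coeff_add, Finsupp.sum_add_index' (by simp) (by intros; ring), ← hf, ← hg]
    have : lconv (f + g) ξ = lconv f ξ + lconv g ξ := by rw [lconv, map_add]; rfl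
    rw [this]
    rfl
  | single y c =>
    rw [MonoidAlgebra.coeff_single, Finsupp.sum_single_index (by simp), lconv, integrate_single]
    rfl

variable (G) in
/-- The reduced group C*-algebra `C*_r(G)`. -/
abbrev ReducedCStar : StarSubalgebra ℂ (Ell2 G →L[ℂ] Ell2 G) := cstarOf (leftRegular G)

end Reduced

/-! ### The full group C*-algebra -/

section Full

/-- A unitary representation of `G` on a Hilbert space. -/
structure UnitaryRep (G : Type u) [Group G] : Type (u + 1) where
  H : Type u
  [normed : NormedAddCommGroup H]
  [inner : InnerProductSpace ℂ H]
  [complete : CompleteSpace H]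
  rep : G →* (H ≃ₗᵢ[ℂ] H)

attribute [instance] UnitaryRep.normed UnitaryRep.inner UnitaryRep.complete

variable (G : Type u) [Group G]

/-- The Hilbert space direct sum of all unitary representations of `G`. (Every cyclic unitary
representation of `G` is equivalent to one on a Hilbert space in the universe of `G`.) -/
abbrev UniversalSpace : Type (u + 1) := lp (fun π : UnitaryRep.{u} G => π.H) 2

variable {G}

theorem memℓp_universal (g : G) (ξ : UniversalSpace G) :
    Memℓp (fun π : UnitaryRep.{u} G => π.rep g (ξ π)) 2 := by
  have h2 : 0 < (2 : ℝ≥0∞).toReal := by simp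
  refine memℓp_gen ?_
  simpa only [LinearIsometryEquiv.norm_map] using ξ.2.summable h2

/-- The action of a group element in the universal representation. -/
def universalAct (g : G) : UniversalSpace G ≃ₗᵢ[ℂ] UniversalSpace G where
  toFun ξ := ⟨fun π => π.rep g (ξ π), memℓp_universal g ξ⟩
  invFun ξ := ⟨fun π => π.rep g⁻¹ (ξ π), memℓp_universal g⁻¹ ξ⟩
  map_add' ξ η := by ext π; exact map_add (π.rep g) (ξ π) (η π)
  map_smul' c ξ := by ext π; simp
  left_inv ξ := by ext π; simp
  right_inv ξ := by ext π; simp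
  norm_map' ξ := by
    have h2 : 0 < (2 : ℝ≥0∞).toReal := by simp
    rw [lp.norm_eq_tsum_rpow h2, lp.norm_eq_tsum_rpow h2]
    simp

@[simp]
theorem universalAct_apply (g : G) (ξ : UniversalSpace G) (π : UnitaryRep.{u} G) :
    universalAct g ξ π = π.rep g (ξ π) := rfl

variable (G)

/-- The universal representation of `G`, the direct sum of all unitary representations. -/
def universalRep : G →* (UniversalSpace G ≃ₗᵢ[ℂ] UniversalSpace G) where
  toFun := universalAct
  map_one' := by ext ξ π; simp
  map_mul' g h := by ext ξ π; simp

/-- The full group C*-algebra `C*(G)`, the closure of `c_c(G)` in the universal representation. -/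
abbrev FullCStar : StarSubalgebra ℂ (UniversalSpace G →L[ℂ] UniversalSpace G) :=
  cstarOf (universalRep G)

end Full

/-! ### The Dirac operator and the seminorm `L_D` -/

section Dirac

/-- `T` is a bounded, everywhere defined extension of the commutator `[D, a]` of an unbounded
operator `D` and a bounded operator `a`: the operator `a` preserves the domain of
`D`, and `T ξ = D (a ξ) - a (D ξ)` for all `ξ` in that domain. -/
def IsCommutator {H : Type v} [NormedAddCommGroup H] [NormedSpace ℂ H]
    (D : H →ₗ.[ℂ] H) (a T : H →L[ℂ] H) : Prop :=
  ∀ ξ : D.domain, ∃ h : a ξ ∈ D.domain, T ξ = D ⟨a ξ, h⟩ - a (D ξ)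

variable {G : Type u}

/-- The self-adjoint operator `M_h` on `ℓ²(G)` of pointwise multiplication by a real function `h`,
with domain `{ξ ∈ ℓ²(G) : h ξ ∈ ℓ²(G)}`. -/
def mulOp (h : G → ℝ) : Ell2 G →ₗ.[ℂ] Ell2 G where
  domain :=
    { carrier := {ξ | Memℓp (fun x => (h x : ℂ) * ξ x) 2}
      add_mem' := by
        intro ξ η hξ hη
        have := hξ.add hη
        refine (congrArg (Memℓp · 2) ?_).mp this
        funext x
        simp [mul_add]
      zero_mem' := by
        refine (congrArg (Memℓp · 2) ?_).mp (zero_memℓp (E := fun _ : G => ℂ))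
        funext x
        simp
      smul_mem' := by
        intro c ξ hξ
        have := hξ.const_smul c
        refine (congrArg (Memℓp · 2) ?_).mp this
        funext x
        simp [mul_left_comm] }
  toFun :=
    { toFun := fun ξ => ⟨fun x => (h x : ℂ) * (ξ : Ell2 G) x, ξ.2⟩
      map_add' := by
        intro ξ η
        ext x
        exact mul_add (h x : ℂ) ((ξ : Ell2 G) x) ((η : Ell2 G) x)
      map_smul' := by
        intro c ξ
        ext x
        simp [mul_left_comm] }

theorem mem_mulOp_domain (h : G → ℝ) (ξ : Ell2 G) :
    ξ ∈ (mulOp h).domain ↔ Memℓp (fun x => (h x : ℂ) * ξ x) 2 := Iff.rfl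

@[simp]
theorem mulOp_apply (h : G → ℝ) (ξ : (mulOp h).domain) (x : G) :
    mulOp h ξ x = (h x : ℂ) * (ξ : Ell2 G) x := rfl

theorem dense_mulOp_domain (h : G → ℝ) : Dense ((mulOp h).domain : Set (Ell2 G)) := by
  classical
  intro ξ
  have hs := lp.hasSum_single (by simp : (2 : ℝ≥0∞) ≠ ⊤) ξ
  refine mem_closure_of_tendsto hs (Filter.Eventually.of_forall fun s => ?_)
  refine Submodule.sum_mem _ fun i _ => ?_
  rw [mem_mulOp_domain]
  refine (congrArg (Memℓp · 2) ?_).mp (lp.single 2 i ((h i : ℂ) * ξ i)).2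
  funext x
  by_cases hx : x = i
  · subst hx; simp
  · simp [hx]

theorem memℓp_bounded_mul {m : G → ℝ} {C : ℝ} (hm : ∀ x, |m x| ≤ C) (ξ : Ell2 G) :
    Memℓp (fun x => (m x : ℂ) * ξ x) 2 := by
  have h2 : 0 < (2 : ℝ≥0∞).toReal := by simp
  refine memℓp_gen (Summable.of_nonneg_of_le (fun x => by positivity) (fun x => ?_)
    (((lp.memℓp ξ).summable h2).mul_left (|C| ^ (2 : ℝ≥0∞).toReal)))
  rw [← Real.mul_rpow (abs_nonneg _) (norm_nonneg _)]
  refine Real.rpow_le_rpow (norm_nonneg _) ?_ h2.le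
  rw [norm_mul, Complex.norm_real, Real.norm_eq_abs]
  exact mul_le_mul_of_nonneg_right ((hm x).trans (le_abs_self C)) (norm_nonneg _)

variable [Group G]

/-- The Dirac operator `D = M_𝕃`. -/
abbrev dirac (𝕃 : LengthFunction G) : Ell2 G →ₗ.[ℂ] Ell2 G := mulOp 𝕃

section Uniqueness

variable {H : Type v} [NormedAddCommGroup H] [NormedSpace ℂ H] {D : H →ₗ.[ℂ] H}
  {a b S T : H →L[ℂ] H}

theorem IsCommutator.unique (hD : Dense (D.domain : Set H)) (hS : IsCommutator D a S)
    (hT : IsCommutator D a T) : S = T := by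
  refine DFunLike.coe_injective (S.continuous.ext_on hD T.continuous fun ξ hξ => ?_)
  obtain ⟨_, h1⟩ := hS ⟨ξ, hξ⟩
  obtain ⟨_, h2⟩ := hT ⟨ξ, hξ⟩
  exact h1.trans h2.symm

theorem IsCommutator.add (hS : IsCommutator D a S) (hT : IsCommutator D b T) :
    IsCommutator D (a + b) (S + T) := by
  intro ξ
  obtain ⟨h1, e1⟩ := hS ξ
  obtain ⟨h2, e2⟩ := hT ξ
  refine ⟨D.domain.add_mem h1 h2, ?_⟩
  have : D ⟨(a + b) ξ, D.domain.add_mem h1 h2⟩ = D ⟨a ξ, h1⟩ + D ⟨b ξ, h2⟩ := by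
    rw [← LinearPMap.map_add]; rfl
  rw [this, add_apply, add_apply, e1, e2]
  abel

theorem IsCommutator.smul (c : ℂ) (hS : IsCommutator D a S) :
    IsCommutator D (c • a) (c • S) := by
  intro ξ
  obtain ⟨h1, e1⟩ := hS ξ
  refine ⟨D.domain.smul_mem c h1, ?_⟩
  have : D ⟨(c • a) ξ, D.domain.smul_mem c h1⟩ = c • D ⟨a ξ, h1⟩ := by
    rw [← LinearPMap.map_smul]; rfl
  rw [this, smul_apply, smul_apply, e1, smul_sub]

theorem IsCommutator.zero : IsCommutator D 0 0 := by
  intro ξ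
  refine ⟨D.domain.zero_mem, ?_⟩
  have : D ⟨(0 : H →L[ℂ] H) ξ, D.domain.zero_mem⟩ = 0 := by
    rw [← LinearPMap.map_zero D]; rfl
  rw [this]
  simp

end Uniqueness

/-- The commutator `[D, λ_g]` with one translation is bounded. -/
theorem exists_isCommutator_translate (𝕃 : LengthFunction G) (g : G) :
    ∃ T, IsCommutator (dirac 𝕃) (lconv (.single g 1)) T := by
  have hb : ∀ x, |𝕃 x - 𝕃 (g⁻¹ * x)| ≤ 𝕃 g := fun x => by
    simpa using 𝕃.abs_sub_le g (g⁻¹ * x)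
  have hlam : ∀ ξ : Ell2 G, lconv (.single g 1) ξ = leftTranslate g ξ := fun ξ => by
    rw [lconv, integrate_single, one_smul]; rfl
  let T₀ : Ell2 G →ₗ[ℂ] Ell2 G :=
    { toFun := fun ξ => ⟨fun x => ((𝕃 x - 𝕃 (g⁻¹ * x) : ℝ) : ℂ) * leftTranslate g ξ x,
        memℓp_bounded_mul hb _⟩
      map_add' := by intro ξ η; ext x; exact mul_add _ (ξ (g⁻¹ * x)) (η (g⁻¹ * x))
      map_smul' := by intro c ξ; ext x; simp [mul_left_comm] }
  have hT₀ : ∀ ξ x, T₀ ξ x = ((𝕃 x - 𝕃 (g⁻¹ * x) : ℝ) : ℂ) * ξ (g⁻¹ * x) := fun _ _ => rfl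
  have hbound : ∀ ξ, ‖T₀ ξ‖ ≤ 𝕃 g * ‖ξ‖ := by
    intro ξ
    have h2 : 0 < (2 : ℝ≥0∞).toReal := by simp
    have hL := 𝕃.nonneg' g
    rw [← (leftTranslate g).norm_map ξ]
    refine lp.norm_le_of_tsum_le h2 (by positivity) ?_
    rw [Real.mul_rpow hL (norm_nonneg _), lp.norm_rpow_eq_tsum h2, ← tsum_mul_left]
    refine ((lp.memℓp (T₀ ξ)).summable h2).tsum_le_tsum (fun x => ?_)
      (((lp.memℓp (leftTranslate g ξ)).summable h2).mul_left _)
    rw [← Real.mul_rpow hL (norm_nonneg _)]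
    refine Real.rpow_le_rpow (norm_nonneg _) ?_ h2.le
    rw [hT₀, norm_mul, Complex.norm_real, Real.norm_eq_abs]
    exact mul_le_mul_of_nonneg_right (hb x) (norm_nonneg _)
  refine ⟨T₀.mkContinuous (𝕃 g) hbound, fun ξ => ?_⟩
  have hmem : lconv (.single g 1) (ξ : Ell2 G) ∈ (dirac 𝕃).domain := by
    rw [mem_mulOp_domain, hlam]
    have h1 := (lp.memℓp (T₀ ξ)).add (lp.memℓp (leftTranslate g (dirac 𝕃 ξ)))
    refine (congrArg (Memℓp · 2) ?_).mp h1
    funext x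
    simp only [Pi.add_apply, hT₀, leftTranslate_apply, mulOp_apply]
    push_cast
    ring
  refine ⟨hmem, ?_⟩
  ext x
  have e1 : lconv (.single g 1) (ξ : Ell2 G) x = (ξ : Ell2 G) (g⁻¹ * x) := by rw [hlam]; rfl
  have e2 : lconv (.single g 1) (dirac 𝕃 ξ) x = (𝕃 (g⁻¹ * x) : ℂ) * (ξ : Ell2 G) (g⁻¹ * x) := by
    rw [hlam]; rfl
  have e3 : (dirac 𝕃 ⟨_, hmem⟩ - lconv (.single g 1) (dirac 𝕃 ξ) : Ell2 G) x =
      (𝕃 x : ℂ) * lconv (.single g 1) (ξ : Ell2 G) x -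
        lconv (.single g 1) (dirac 𝕃 ξ) x := rfl
  rw [e3, e1, e2]
  refine (hT₀ ξ x).trans ?_
  push_cast
  ring

/-- For `f ∈ c_c(G)` the commutator `[D, λ_f]` extends to a bounded operator. -/
theorem exists_isCommutator (𝕃 : LengthFunction G) (f : ℂ[G]) :
    ∃ T, IsCommutator (dirac 𝕃) (lconv f) T := by
  induction f using MonoidAlgebra.induction_linear with
  | zero => exact ⟨0, by rw [lconv, map_zero]; exact IsCommutator.zero⟩
  | add f g hf hg =>
    obtain ⟨S, hS⟩ := hf
    obtain ⟨T, hT⟩ := hg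
    exact ⟨S + T, by rw [lconv, map_add]; exact hS.add hT⟩
  | single g c =>
    obtain ⟨T, hT⟩ := exists_isCommutator_translate 𝕃 g
    refine ⟨c • T, ?_⟩
    have : lconv (.single g c) = c • lconv (.single g 1) := by
      rw [lconv, lconv, ← map_smul, MonoidAlgebra.smul_single, smul_eq_mul, mul_one]
    rw [this]
    exact hT.smul c

/-- The bounded operator `[D, λ_f]` on `ℓ²(G)`, for `D = M_𝕃`: the unique bounded extension of
the commutator (uniqueness is `commutator_eq`). -/
def commutator (𝕃 : LengthFunction G) (f : ℂ[G]) : Ell2 G →L[ℂ] Ell2 G :=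
  (exists_isCommutator 𝕃 f).choose

theorem isCommutator_commutator (𝕃 : LengthFunction G) (f : ℂ[G]) :
    IsCommutator (dirac 𝕃) (lconv f) (commutator 𝕃 f) :=
  (exists_isCommutator 𝕃 f).choose_spec

theorem commutator_eq (𝕃 : LengthFunction G) {f : ℂ[G]} {T : Ell2 G →L[ℂ] Ell2 G}
    (hT : IsCommutator (dirac 𝕃) (lconv f) T) : commutator 𝕃 f = T :=
  (isCommutator_commutator 𝕃 f).unique (dense_mulOp_domain _) hT

/-- The seminorm `L_D(f) = ‖[D, λ_f]‖` on `c_c(G)`. -/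
def seminormLD (𝕃 : LengthFunction G) : Seminorm ℂ ℂ[G] :=
  Seminorm.of (fun f => ‖commutator 𝕃 f‖)
    (fun f g => by
      have : commutator 𝕃 (f + g) = commutator 𝕃 f + commutator 𝕃 g := commutator_eq 𝕃 (by
        rw [lconv, map_add]
        exact (isCommutator_commutator 𝕃 f).add (isCommutator_commutator 𝕃 g))
      rw [this]
      exact norm_add_le _ _)
    (fun c f => by
      have : commutator 𝕃 (c • f) = c • commutator 𝕃 f := commutator_eq 𝕃 (by
        rw [lconv, map_smul]
        exact (isCommutator_commutator 𝕃 f).smul c)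
      rw [this, norm_smul])

end Dirac

/-! ### States, the Connes metric and Lip-norms -/

section LipNorm

variable (A : Type v) [CStarAlgebra A]

/-- The state space of a unital C*-algebra: the positive linear functionals of value `1` at `1`.
As a subtype of `WeakDual ℂ A` it carries the weak-* topology. -/
def stateSpace : Set (WeakDual ℂ A) :=
  {φ | φ 1 = 1 ∧ ∀ a : A, 0 ≤ φ (star a * a)}

variable {A} {𝒜 : Type w} [Ring 𝒜] [Algebra ℂ 𝒜] [StarRing 𝒜]

/-- The Connes metric `ρ_L(μ, ν) = sup {|μ(a) - ν(a)| : a ∈ 𝒜, L(a) ≤ 1}`, with values in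
`[0, ∞]`, where `𝒜` is regarded as a subalgebra of `A` through `ι`. -/
def connesDist (ι : 𝒜 →⋆ₐ[ℂ] A) (L : Seminorm ℂ 𝒜) (μ ν : stateSpace A) : ℝ≥0∞ :=
  ⨆ (a : 𝒜) (_ : L a ≤ 1), ENNReal.ofReal ‖μ.1 (ι a) - ν.1 (ι a)‖

/-- The state space with the metric `ρ_L`. -/
@[reducible]
def connesMetric (ι : 𝒜 →⋆ₐ[ℂ] A) (L : Seminorm ℂ 𝒜) : PseudoEMetricSpace (stateSpace A) where
  edist := connesDist ι L
  edist_self μ := by simp [connesDist]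
  edist_comm μ ν := by simp only [connesDist, norm_sub_rev]
  edist_triangle μ ν κ := by
    refine iSup₂_le fun a ha => ?_
    refine le_trans ?_ (add_le_add
      (le_iSup₂ (f := fun (a : 𝒜) (_ : L a ≤ 1) => ENNReal.ofReal ‖μ.1 (ι a) - ν.1 (ι a)‖) a ha)
      (le_iSup₂ (f := fun (a : 𝒜) (_ : L a ≤ 1) => ENNReal.ofReal ‖ν.1 (ι a) - κ.1 (ι a)‖) a ha))
    rw [← ENNReal.ofReal_add (norm_nonneg _) (norm_nonneg _)]
    exact ENNReal.ofReal_le_ofReal (norm_sub_le_norm_sub_add_norm_sub _ _ _)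

/-- `L` is a Lip-norm on the unital C*-algebra `A`: `ι` identifies `𝒜` with a dense `*`-subalgebra
of `A`, `L` is a `*`-seminorm on it with `L(1) = 0`, and the topology of the metric `ρ_L` on the
state space of `A` is the weak-* topology. -/
structure IsLipNorm (ι : 𝒜 →⋆ₐ[ℂ] A) (L : Seminorm ℂ 𝒜) : Prop where
  injective : Function.Injective ι
  denseRange : DenseRange ι
  map_star : ∀ a, L (star a) = L a
  map_one : L 1 = 0
  topology_eq :
    (connesMetric ι L).toUniformSpace.toTopologicalSpace =
      (instTopologicalSpaceSubtype : TopologicalSpace (stateSpace A))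

end LipNorm

end GroupCStar

end

/-!
By Rieffel's criterion it suffices that `{f | L_D(f) ≤ 1, f(e) = 0}` has totally bounded image in
the C*-algebra. Its elements satisfy `|f(z)| ≤ 1 / 𝕃(z)` for `z ≠ e`, so the task is to approximate
`f` in norm, uniformly, by truncations of `f` to a fixed ball.

Consider the block of the matrix `f(xu⁻¹)` of `λ_f` with rows `x ∈ X = {2R < 𝕃 ≤ 16R}` and columns
`u ∈ U = {𝕃 ≤ R}`. Since `𝕃(x)` and `𝕃(u)` are separated by a gap `R`, the norm of the block is at
most `‖[D, λ_f]‖ / R`. The average `|U|⁻¹ ∑ f(xu⁻¹) π(x) π(u)⁻¹` over the block is `π(φf)` for a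
cutoff function `φ` equal to `1` on the annulus `3R < 𝕃 ≤ 15R`. By Cauchy-Schwarz its norm exceeds
that of the block by at most the factor `√(|X| / |U|)`, in every unitary representation `π` of `G`
and not just the regular one, and doubling bounds this factor. Taking balls for `X` instead gives
the truncations; those to the radii `2ⁿ` differ consecutively only on an annulus, hence by
`O(2⁻ⁿ L_D(f))`, and their differences telescope to `f`.
-/

noncomputable section

namespace GroupCStar

universe u v w

open Filter Topology

open scoped Matrix.Norms.L2Operator BigOperators

/-! ### Rieffel's criterion -/

section Rieffel

variable {A : Type v} [CStarAlgebra A]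

theorem norm_apply_le_of_mem_stateSpace {φ : WeakDual ℂ A} (hφ : φ ∈ stateSpace A) (a : A) :
    ‖φ a‖ ≤ ‖a‖ := by
  let _ := CStarAlgebra.spectralOrder A
  have := CStarAlgebra.spectralOrderedRing A
  let ψ : A →ₚ[ℂ] ℂ := PositiveLinearMap.mk₀ (φ : A →L[ℂ] ℂ) fun b hb => by
    obtain ⟨c, rfl⟩ := CStarAlgebra.nonneg_iff_eq_star_mul_self.1 hb
    exact hφ.2 c
  have hψ_one : ψ 1 = 1 := hφ.1
  have hone : ‖ψ.toPreGNS 1‖ = 1 := by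
    rw [ψ.preGNS_norm_def]
    simp [hψ_one]
  have hsq : ‖ψ.toPreGNS a‖ ^ 2 ≤ ‖a‖ ^ 2 := by
    have h := ψ.norm_apply_le_of_nonneg (star a * a) (star_mul_self_nonneg a)
    rwa [hψ_one, norm_one, one_mul, CStarRing.norm_star_mul_self, ← sq,
      ← ψ.ofPreGNS_toPreGNS a, ← ψ.preGNS_norm_sq, norm_pow, Complex.norm_real, norm_norm] at h
  calc ‖φ a‖ = ‖inner ℂ (ψ.toPreGNS 1) (ψ.toPreGNS a)‖ := by
        rw [ψ.preGNS_inner_def, ψ.ofPreGNS_toPreGNS, ψ.ofPreGNS_toPreGNS, star_one, one_mul]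
        rfl
    _ ≤ ‖ψ.toPreGNS 1‖ * ‖ψ.toPreGNS a‖ := norm_inner_le_norm _ _
    _ ≤ ‖a‖ := by
        rw [hone, one_mul]
        exact le_of_sq_le_sq hsq (norm_nonneg a)

theorem norm_apply_sub_apply_le (μ ν : stateSpace A) (a b : A) :
    ‖μ.1 a - ν.1 a‖ ≤ 2 * ‖a - b‖ + ‖μ.1 b - ν.1 b‖ := by
  have hμ := norm_apply_le_of_mem_stateSpace μ.2 (a - b)
  have hν := norm_apply_le_of_mem_stateSpace ν.2 (a - b)
  rw [map_sub] at hμ hν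
  calc ‖μ.1 a - ν.1 a‖ = ‖(μ.1 a - μ.1 b) - (ν.1 a - ν.1 b) + (μ.1 b - ν.1 b)‖ := by
        congr 1; ring
    _ ≤ ‖μ.1 a - μ.1 b‖ + ‖ν.1 a - ν.1 b‖ + ‖μ.1 b - ν.1 b‖ :=
        norm_add_le_of_le (norm_sub_le _ _) le_rfl
    _ ≤ 2 * ‖a - b‖ + ‖μ.1 b - ν.1 b‖ := by linarith

variable {𝒜 : Type w} [Ring 𝒜] [Algebra ℂ 𝒜] [StarRing 𝒜] (ι : 𝒜 →⋆ₐ[ℂ] A) (L : Seminorm ℂ 𝒜)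

theorem enorm_apply_sub_apply_le_mul_connesDist (μ ν : stateSpace A) (a : 𝒜) :
    ‖μ.1 (ι a) - ν.1 (ι a)‖ₑ ≤ ENNReal.ofReal (L a + 1) * connesDist ι L μ ν := by
  have hpos : 0 < L a + 1 := by linarith [apply_nonneg L a]
  set c : ℂ := Complex.ofReal (L a + 1)⁻¹ with hcdef
  have hc : ‖c‖ = (L a + 1)⁻¹ := by
    rw [hcdef, Complex.norm_real, Real.norm_eq_abs, abs_of_pos (inv_pos.2 hpos)]
  have hLc : L (c • a) ≤ 1 := by
    rw [map_smul_eq_mul, hc, inv_mul_le_iff₀ hpos]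
    linarith
  have hle : ENNReal.ofReal ‖μ.1 (ι (c • a)) - ν.1 (ι (c • a))‖ ≤ connesDist ι L μ ν :=
    le_iSup₂ (f := fun (a : 𝒜) (_ : L a ≤ 1) => ENNReal.ofReal ‖μ.1 (ι a) - ν.1 (ι a)‖) _ hLc
  calc ‖μ.1 (ι a) - ν.1 (ι a)‖ₑ
      = ENNReal.ofReal ((L a + 1) * ‖μ.1 (ι (c • a)) - ν.1 (ι (c • a))‖) := by
        rw [map_smul, map_smul, map_smul, ← smul_sub, norm_smul, hc, mul_inv_cancel_left₀ hpos.ne',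
          ofReal_norm]
    _ ≤ ENNReal.ofReal (L a + 1) * connesDist ι L μ ν := by
        rw [ENNReal.ofReal_mul hpos.le]
        gcongr

variable {ι}

theorem topology_connesMetric_le (hι : DenseRange ι) :
    (connesMetric ι L).toUniformSpace.toTopologicalSpace ≤
      (instTopologicalSpaceSubtype : TopologicalSpace (stateSpace A)) := by
  rw [← continuous_id_iff_le, continuous_induced_rng]
  refine @WeakDual.continuous_of_continuous_eval _ _ _ _ _ _ _ _ _ _
    (connesMetric ι L).toUniformSpace.toTopologicalSpace _ fun a => ?_
  have hrange (b : 𝒜) : @Continuous _ _ (connesMetric ι L).toUniformSpace.toTopologicalSpace _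
      fun ν : stateSpace A => ν.1 (ι b) := by
    refine @LipschitzWith.continuous _ _ (connesMetric ι L) _ (L b + 1).toNNReal _ fun μ ν => ?_
    rw [edist_eq_enorm_sub]
    exact enorm_apply_sub_apply_le_mul_connesDist ι L μ ν b
  refine @continuous_of_uniform_approx_of_continuous _ _
    (connesMetric ι L).toUniformSpace.toTopologicalSpace _ _ fun u hu => ?_
  obtain ⟨ε, hε, hεu⟩ := Metric.mem_uniformity_dist.1 hu
  obtain ⟨b, hb⟩ := hι.exists_dist_lt a hε
  refine ⟨_, hrange b, fun ν => hεu ?_⟩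
  change dist (ν.1 a) (ν.1 (ι b)) < ε
  rw [dist_eq_norm, ← map_sub]
  exact (norm_apply_le_of_mem_stateSpace ν.2 _).trans_lt (dist_eq_norm a (ι b) ▸ hb)

variable {L} {B : Set 𝒜}

theorem eventually_connesDist_le (hB : TotallyBounded (ι '' B))
    (hLB : ∀ a, L a ≤ 1 → ∃ c : ℂ, a - algebraMap ℂ 𝒜 c ∈ B) (μ : stateSpace A) {ε : ℝ}
    (hε : 0 < ε) : ∀ᶠ ν in 𝓝 μ, connesDist ι L ν μ ≤ ENNReal.ofReal ε := by
  obtain ⟨t, ht, hBt⟩ := Metric.totallyBounded_iff.1 hB (ε / 3) (by positivity)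
  have hnet : ∀ᶠ ν in 𝓝 μ, ∀ y ∈ t, ‖ν.1 y - μ.1 y‖ < ε / 3 := by
    refine (eventually_all_finite ht).2 fun y _ => ?_
    have hcont : Continuous fun ν : stateSpace A => ‖ν.1 y - μ.1 y‖ :=
      (((WeakDual.eval_continuous y).comp continuous_subtype_val).sub continuous_const).norm
    exact hcont.continuousAt.eventually_lt_const (by simpa using by positivity)
  filter_upwards [hnet] with ν hν
  refine iSup₂_le fun a ha => ENNReal.ofReal_le_ofReal ?_
  obtain ⟨c, hc⟩ := hLB a ha
  obtain ⟨y, hy, hay⟩ := Set.mem_iUnion₂.1 (hBt (Set.mem_image_of_mem ι hc))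
  rw [Metric.mem_ball, dist_eq_norm] at hay
  have hscalar (κ : stateSpace A) : κ.1 (ι (a - algebraMap ℂ 𝒜 c)) = κ.1 (ι a) - c := by
    rw [map_sub, AlgHomClass.commutes, map_sub, Algebra.algebraMap_eq_smul_one, map_smul, κ.2.1,
      smul_eq_mul, mul_one]
  have h := norm_apply_sub_apply_le ν μ (ι (a - algebraMap ℂ 𝒜 c)) y
  rw [hscalar, hscalar, sub_sub_sub_cancel_right] at h
  linarith [hν y hy]

theorem connesMetric_topology_eq (hι : DenseRange ι) (hB : TotallyBounded (ι '' B))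
    (hLB : ∀ a, L a ≤ 1 → ∃ c : ℂ, a - algebraMap ℂ 𝒜 c ∈ B) :
    (connesMetric ι L).toUniformSpace.toTopologicalSpace =
      (instTopologicalSpaceSubtype : TopologicalSpace (stateSpace A)) := by
  refine (topology_connesMetric_le L hι).antisymm (le_of_nhds_le_nhds fun μ => ?_)
  refine (@Metric.nhds_basis_closedEBall (stateSpace A) (connesMetric ι L) μ).ge_iff.2
    fun ε hε => ?_
  obtain ⟨r, hr, hrε⟩ := ENNReal.lt_iff_exists_nnreal_btwn.1 hε
  filter_upwards [eventually_connesDist_le hB hLB μ (NNReal.coe_pos.2 (by exact_mod_cast hr))]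
    with ν hν
  exact hν.trans (by simpa using hrε.le)

end Rieffel

/-! ### The operator norm of a matrix -/

section MatrixNorm

variable {𝕜 m n : Type*} [RCLike 𝕜] [Fintype m] [Fintype n] [DecidableEq n]

theorem sum_norm_mulVec_sq_le (A : Matrix m n 𝕜) (x : n → 𝕜) :
    ∑ i, ‖∑ j, A i j * x j‖ ^ 2 ≤ ‖A‖ ^ 2 * ∑ j, ‖x j‖ ^ 2 := by
  have h := pow_le_pow_left₀ (norm_nonneg _) (A.l2_opNorm_mulVec (WithLp.toLp 2 x)) 2
  rwa [mul_pow, EuclideanSpace.norm_sq_eq, EuclideanSpace.norm_sq_eq] at h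

theorem sum_norm_sum_smul_sq_le {H : Type*} [NormedAddCommGroup H] [InnerProductSpace 𝕜 H]
    (A : Matrix m n 𝕜) (ξ : n → H) :
    ∑ i, ‖∑ j, A i j • ξ j‖ ^ 2 ≤ ‖A‖ ^ 2 * ∑ j, ‖ξ j‖ ^ 2 := by
  let W := Submodule.span 𝕜 (Set.range ξ)
  have : FiniteDimensional 𝕜 W := .span_of_finite 𝕜 (Set.finite_range ξ)
  let ξ' (j : n) : W := ⟨ξ j, Submodule.subset_span ⟨j, rfl⟩⟩
  let b := stdOrthonormalBasis 𝕜 W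
  have hcoord (i : m) (k) :
      inner 𝕜 (b k) (∑ j, A i j • ξ' j) = ∑ j, A i j * inner 𝕜 (b k) (ξ' j) := by
    simp only [inner_sum, inner_smul_right]
  calc ∑ i, ‖∑ j, A i j • ξ j‖ ^ 2 = ∑ i, ‖∑ j, A i j • ξ' j‖ ^ 2 := by
        simp only [← Submodule.norm_coe, Submodule.coe_sum, Submodule.coe_smul, ξ']
    _ = ∑ k, ∑ i, ‖∑ j, A i j * inner 𝕜 (b k) (ξ' j)‖ ^ 2 := by
        simp only [← b.sum_sq_norm_inner_right, hcoord]
        exact Finset.sum_comm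
    _ ≤ ∑ k, ‖A‖ ^ 2 * ∑ j, ‖inner 𝕜 (b k) (ξ' j)‖ ^ 2 := by
        gcongr with k
        exact sum_norm_mulVec_sq_le A _
    _ = ‖A‖ ^ 2 * ∑ j, ‖ξ j‖ ^ 2 := by
        rw [← Finset.mul_sum, Finset.sum_comm]
        simp only [b.sum_sq_norm_inner_right]
        rfl

theorem norm_matrix_inner_le {E F : Type*} [NormedAddCommGroup E] [InnerProductSpace 𝕜 E]
    [NormedAddCommGroup F] [InnerProductSpace 𝕜 F] {e : n → E} {f : m → F}
    (he : Orthonormal 𝕜 e) (hf : Orthonormal 𝕜 f) (T : E →L[𝕜] F) :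
    ‖Matrix.of fun i j => inner 𝕜 (f i) (T (e j))‖ ≤ ‖T‖ := by
  rw [Matrix.l2_opNorm_def]
  refine ContinuousLinearMap.opNorm_le_bound _ (norm_nonneg T) fun x => ?_
  refine le_of_sq_le_sq ?_ (by positivity)
  have hx : ‖∑ j, x j • e j‖ ^ 2 = ‖x‖ ^ 2 := by
    rw [EuclideanSpace.norm_sq_eq, ← RCLike.ofReal_inj (K := 𝕜), RCLike.ofReal_pow,
      ← inner_self_eq_norm_sq_to_K, he.inner_sum]
    simp [RCLike.conj_mul]
  calc _ = ∑ i, ‖inner 𝕜 (f i) (T (∑ j, x j • e j))‖ ^ 2 := by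
        rw [EuclideanSpace.norm_sq_eq]
        simp [Matrix.mulVec, dotProduct, inner_sum, inner_smul_right, mul_comm]
    _ ≤ ‖T (∑ j, x j • e j)‖ ^ 2 := hf.sum_inner_products_le _
    _ ≤ (‖T‖ * ‖∑ j, x j • e j‖) ^ 2 := by
        gcongr
        exact T.le_opNorm _
    _ = (‖T‖ * ‖x‖) ^ 2 := by rw [mul_pow, hx, mul_pow]

theorem sub_mul_norm_le_norm_diagonal_mul_sub [DecidableEq m] {p : m → 𝕜} {q : n → 𝕜} {r s : ℝ}
    (hs : 0 < s) (hp : ∀ i, s ≤ ‖p i‖) (hr : 0 ≤ r) (hq : ∀ j, ‖q j‖ ≤ r) (A : Matrix m n 𝕜) :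
    (s - r) * ‖A‖ ≤ ‖Matrix.diagonal p * A - A * Matrix.diagonal q‖ := by
  have hleft : s * ‖A‖ ≤ ‖Matrix.diagonal p * A‖ := by
    have hinv : Matrix.diagonal (fun i => (p i)⁻¹) * (Matrix.diagonal p * A) = A := by
      rw [← Matrix.mul_assoc, Matrix.diagonal_mul_diagonal]
      simp [inv_mul_cancel₀ (norm_pos_iff.1 (hs.trans_le (hp _)))]
    have hnorm : ‖Matrix.diagonal (fun i => (p i)⁻¹)‖ ≤ s⁻¹ := by
      rw [Matrix.l2_opNorm_diagonal, pi_norm_le_iff_of_nonneg (inv_nonneg.2 hs.le)]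
      intro i
      rw [norm_inv]
      exact inv_anti₀ hs (hp i)
    rw [← le_inv_mul_iff₀ hs]
    calc ‖A‖ ≤ ‖Matrix.diagonal (fun i => (p i)⁻¹)‖ * ‖Matrix.diagonal p * A‖ := by
          conv_lhs => rw [← hinv]
          exact Matrix.l2_opNorm_mul _ _
      _ ≤ s⁻¹ * ‖Matrix.diagonal p * A‖ := by gcongr
  have hright : ‖A * Matrix.diagonal q‖ ≤ r * ‖A‖ := by
    have hnorm : ‖Matrix.diagonal q‖ ≤ r := by
      rwa [Matrix.l2_opNorm_diagonal, pi_norm_le_iff_of_nonneg hr]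
    calc ‖A * Matrix.diagonal q‖ ≤ ‖A‖ * ‖Matrix.diagonal q‖ := Matrix.l2_opNorm_mul _ _
      _ ≤ r * ‖A‖ := by rw [mul_comm]; gcongr
  linarith [norm_sub_norm_le (Matrix.diagonal p * A) (A * Matrix.diagonal q)]

end MatrixNorm

/-! ### Matrix coefficients of convolution operators and their commutators -/

section LengthFunction

variable {G : Type u} [Group G] (𝕃 : LengthFunction G)

theorem LengthFunction.map_one : 𝕃 1 = 0 :=
  (𝕃.eq_zero_iff' 1).2 rfl

theorem LengthFunction.le_map_mul_add (z u : G) : 𝕃 z ≤ 𝕃 (z * u) + 𝕃 u := by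
  simpa only [mul_inv_cancel_right, 𝕃.inv'] using 𝕃.mul_le' (z * u) u⁻¹

end LengthFunction

section HilbertBasisExt

variable {𝕜 I E : Type*} [RCLike 𝕜] [NormedAddCommGroup E] [InnerProductSpace 𝕜 E]

theorem ext_inner_hilbertBasis (b : HilbertBasis I 𝕜 E) {S T : E →L[𝕜] E}
    (h : ∀ i j, inner 𝕜 (b i) (S (b j)) = inner 𝕜 (b i) (T (b j))) : S = T := by
  refine ContinuousLinearMap.ext_on
    (Submodule.dense_iff_topologicalClosure_eq_top.2 b.dense_span) ?_
  rintro _ ⟨j, rfl⟩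
  refine b.repr.injective (lp.ext (funext fun i => ?_))
  rw [b.repr_apply_apply, b.repr_apply_apply, h]

end HilbertBasisExt

section DeltaBasis

variable (G : Type u)

/-- The canonical orthonormal basis of `ℓ²(G)`, the indicator functions of the points of `G`. -/
def deltaBasis : HilbertBasis G ℂ (Ell2 G) := .ofRepr (.refl ℂ (Ell2 G))

variable {G}

theorem inner_deltaBasis (x : G) (ξ : Ell2 G) : inner ℂ (deltaBasis G x) ξ = ξ x := by
  rw [← HilbertBasis.repr_apply_apply]
  rfl

theorem deltaBasis_apply [DecidableEq G] (u x : G) :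
    deltaBasis G u x = if x = u then 1 else 0 := by
  rw [← inner_deltaBasis, orthonormal_iff_ite.1 (deltaBasis G).orthonormal]

theorem coe_mul_deltaBasis (h : G → ℝ) (u : G) :
    (fun x => (h x : ℂ) * deltaBasis G u x) = ⇑((h u : ℂ) • deltaBasis G u) := by
  classical
  ext x
  rw [lp.coeFn_smul, Pi.smul_apply, smul_eq_mul, deltaBasis_apply]
  split_ifs with hx
  · rw [hx]
  · rw [mul_zero, mul_zero]

theorem deltaBasis_mem_mulOp_domain (h : G → ℝ) (u : G) :
    deltaBasis G u ∈ (mulOp h).domain := by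
  rw [mem_mulOp_domain, coe_mul_deltaBasis]
  exact lp.memℓp _

theorem mulOp_deltaBasis (h : G → ℝ) (u : G) :
    mulOp h ⟨deltaBasis G u, deltaBasis_mem_mulOp_domain h u⟩ = (h u : ℂ) • deltaBasis G u :=
  lp.ext (coe_mul_deltaBasis h u)

theorem norm_matrix_inner_deltaBasis_le [DecidableEq G] (X U : Finset G)
    (T : Ell2 G →L[ℂ] Ell2 G) :
    ‖(.of fun x u => inner ℂ (deltaBasis G x) (T (deltaBasis G u)) : Matrix X U ℂ)‖ ≤ ‖T‖ :=
  norm_matrix_inner_le ((deltaBasis G).orthonormal.comp _ Subtype.val_injective)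
    ((deltaBasis G).orthonormal.comp _ Subtype.val_injective) T

variable [Group G]

theorem inner_deltaBasis_lconv (f : ℂ[G]) (x u : G) :
    inner ℂ (deltaBasis G x) (lconv f (deltaBasis G u)) = f.coeff (x * u⁻¹) := by
  classical
  rw [inner_deltaBasis, lconv_apply]
  have hsupp (y : G) : y⁻¹ * x = u ↔ x * u⁻¹ = y := by
    rw [inv_mul_eq_iff_eq_mul, mul_inv_eq_iff_eq_mul]
  simp only [deltaBasis_apply, hsupp, mul_ite, mul_one, mul_zero]
  rw [Finsupp.sum_ite_eq, ite_eq_left_iff]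
  exact fun hx => (Finsupp.notMem_support_iff.1 hx).symm

theorem inner_deltaBasis_commutator (𝕃 : LengthFunction G) (f : ℂ[G]) (x u : G) :
    inner ℂ (deltaBasis G x) (commutator 𝕃 f (deltaBasis G u)) =
      ((𝕃 x : ℂ) - 𝕃 u) * f.coeff (x * u⁻¹) := by
  obtain ⟨hmem, hcomm⟩ :=
    isCommutator_commutator 𝕃 f ⟨deltaBasis G u, deltaBasis_mem_mulOp_domain 𝕃 u⟩
  rw [hcomm, mulOp_deltaBasis, map_smul, inner_sub_right, inner_smul_right,
    inner_deltaBasis x (dirac 𝕃 _), mulOp_apply, ← inner_deltaBasis x (lconv f _),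
    inner_deltaBasis_lconv, sub_mul]

end DeltaBasis

section SeminormLD

variable {G : Type u} [Group G] (𝕃 : LengthFunction G) (f : ℂ[G])

theorem seminormLD_apply : seminormLD 𝕃 f = ‖commutator 𝕃 f‖ := rfl

theorem commutator_star : commutator 𝕃 (star f) = -star (commutator 𝕃 f) := by
  refine ext_inner_hilbertBasis (deltaBasis G) fun x u => ?_
  rw [neg_apply, inner_neg_right, ContinuousLinearMap.star_eq_adjoint,
    ContinuousLinearMap.adjoint_inner_right,
    ← inner_conj_symm (commutator 𝕃 f (deltaBasis G x)), inner_deltaBasis_commutator,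
    inner_deltaBasis_commutator, coeff_star, mul_inv_rev, inv_inv,
    map_mul (starRingEnd ℂ), map_sub,
    Complex.conj_ofReal, Complex.conj_ofReal, starRingEnd_apply]
  ring

theorem seminormLD_star : seminormLD 𝕃 (star f) = seminormLD 𝕃 f := by
  rw [seminormLD_apply, seminormLD_apply, commutator_star, norm_neg,
    ContinuousLinearMap.star_eq_adjoint, LinearIsometryEquiv.norm_map]

theorem seminormLD_one : seminormLD 𝕃 1 = 0 := by
  classical
  rw [seminormLD_apply, norm_eq_zero]
  refine ext_inner_hilbertBasis (deltaBasis G) fun x u => ?_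
  rw [inner_deltaBasis_commutator, MonoidAlgebra.one_def, MonoidAlgebra.coeff_single,
    Finsupp.single_apply]
  by_cases hxu : x = u <;> simp [hxu, eq_comm (a := (1 : G)), mul_inv_eq_one]

theorem length_mul_norm_coeff_le (z : G) : 𝕃 z * ‖f.coeff z‖ ≤ seminormLD 𝕃 f := by
  have h := norm_inner_le_norm (𝕜 := ℂ) (deltaBasis G z) (commutator 𝕃 f (deltaBasis G 1))
  rw [inner_deltaBasis_commutator, 𝕃.map_one, Complex.ofReal_zero, sub_zero,
    inv_one, mul_one, norm_mul, Complex.norm_real, Real.norm_of_nonneg (𝕃.nonneg' z)] at h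
  have hbasis (x : G) : ‖deltaBasis G x‖ = 1 := (deltaBasis G).orthonormal.1 x
  calc 𝕃 z * ‖f.coeff z‖ ≤ ‖commutator 𝕃 f (deltaBasis G 1)‖ := by rwa [hbasis, one_mul] at h
    _ ≤ ‖commutator 𝕃 f‖ := (commutator 𝕃 f).unit_le_opNorm _ (hbasis 1).le

end SeminormLD

section Block

variable {G : Type u} [Group G] (f : ℂ[G]) (X U : Finset G)

/-- The block, with rows in `X` and columns in `U`, of the matrix of left convolution by `f`. -/
def lconvBlock : Matrix X U ℂ := .of fun x u => f.coeff (x * (u : G)⁻¹)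

variable [DecidableEq G]

theorem norm_lconvBlock_le : ‖lconvBlock f X U‖ ≤ ‖lconv f‖ := by
  simpa only [inner_deltaBasis_lconv, lconvBlock] using
    norm_matrix_inner_deltaBasis_le X U (lconv f)

theorem sub_mul_norm_lconvBlock_le (𝕃 : LengthFunction G) {r s : ℝ} (hs : 0 < s)
    (hX : ∀ x ∈ X, s ≤ 𝕃 x) (hr : 0 ≤ r) (hU : ∀ u ∈ U, 𝕃 u ≤ r) :
    (s - r) * ‖lconvBlock f X U‖ ≤ seminormLD 𝕃 f := by
  have hnorm (z : G) : ‖(𝕃 z : ℂ)‖ = 𝕃 z := by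
    rw [Complex.norm_real, Real.norm_of_nonneg (𝕃.nonneg' z)]
  have hcomm : Matrix.diagonal (fun x : X => (𝕃 x : ℂ)) * lconvBlock f X U -
      lconvBlock f X U * Matrix.diagonal (fun u : U => (𝕃 u : ℂ)) =
      .of fun x u => inner ℂ (deltaBasis G x) (commutator 𝕃 f (deltaBasis G u)) := by
    ext x u
    simp only [lconvBlock, Matrix.sub_apply, Matrix.diagonal_mul, Matrix.mul_diagonal,
      Matrix.of_apply, inner_deltaBasis_commutator]
    ring
  refine (sub_mul_norm_le_norm_diagonal_mul_sub hs (fun x => ?_) hr (fun u => ?_) _).trans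
    (hcomm ▸ norm_matrix_inner_deltaBasis_le X U (commutator 𝕃 f))
  · exact (hX x x.2).trans_eq (hnorm x).symm
  · exact (hnorm u).trans_le (hU u u.2)

end Block

/-! ### Transference to unitary representations -/

section PointwiseMul

variable {G : Type u}

/-- The pointwise product of a function on `G` and an element of `c_c(G)`. -/
def pointwiseMul (φ : G → ℂ) (f : ℂ[G]) : ℂ[G] :=
  .ofCoeff (Finsupp.onFinset f.coeff.support (fun z => φ z * f.coeff z) fun _ hz =>
    Finsupp.mem_support_iff.2 (right_ne_zero_of_mul hz))

@[simp]
theorem coeff_pointwiseMul (φ : G → ℂ) (f : ℂ[G]) (z : G) :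
    (pointwiseMul φ f).coeff z = φ z * f.coeff z := rfl

theorem pointwiseMul_eq_self {φ : G → ℂ} {f : ℂ[G]} (h : ∀ z, f.coeff z ≠ 0 → φ z = 1) :
    pointwiseMul φ f = f := by
  ext z
  by_cases hz : f.coeff z = 0
  · rw [coeff_pointwiseMul, hz, mul_zero]
  · rw [coeff_pointwiseMul, h z hz, one_mul]

theorem eq_sum_single {f : ℂ[G]} {s : Finset G} (hs : ∀ z, f.coeff z ≠ 0 → z ∈ s) :
    f = ∑ z ∈ s, MonoidAlgebra.single z (f.coeff z) := by
  classical
  ext x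
  simpa [Finsupp.single_apply] using not_imp_comm.1 (hs x)

end PointwiseMul

section Transference

variable {G : Type u} [Group G] {X U : Finset G}

/-- The proportion of elements of `U` that left translation by `z` moves into `X`. -/
def cutoff (X U : Finset G) (z : G) : ℂ := 𝔼 u ∈ U, (X : Set G).indicator 1 (z * u)

theorem cutoff_eq_one (hU : U.Nonempty) {z : G} (h : ∀ u ∈ U, z * u ∈ X) : cutoff X U z = 1 := by
  rw [cutoff, Finset.expect_congr rfl fun u hu => Set.indicator_of_mem (h u hu) 1]
  exact Finset.expect_const hU 1

theorem cutoff_eq_zero {z : G} (h : ∀ u ∈ U, z * u ∉ X) : cutoff X U z = 0 := by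
  rw [cutoff, Finset.expect_congr rfl fun u hu => Set.indicator_of_notMem (h u hu) 1]
  exact Finset.expect_const_zero _

theorem card_smul_pointwiseMul_cutoff (X U : Finset G) (f : ℂ[G]) :
    U.card • pointwiseMul (cutoff X U) f =
      ∑ x ∈ X, ∑ u ∈ U, MonoidAlgebra.single (x * u⁻¹) (f.coeff (x * u⁻¹)) := by
  classical
  ext z
  have hsum (u : G) : ∑ x ∈ X, Finsupp.single (x * u⁻¹) (f.coeff (x * u⁻¹)) z =
      (X : Set G).indicator 1 (z * u) * f.coeff z := by
    have hz (x : G) : (Finsupp.single (x * u⁻¹) (f.coeff (x * u⁻¹)) : G →₀ ℂ) z =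
        if z * u = x then f.coeff z else 0 := by
      rw [Finsupp.single_apply, eq_comm (a := x * u⁻¹), eq_mul_inv_iff_mul_eq]
      split_ifs with h
      · rw [← h, mul_inv_cancel_right]
      · rfl
    simp only [hz, Finset.sum_ite_eq, Set.indicator_apply, Finset.mem_coe, Pi.one_apply, ite_mul,
      one_mul, zero_mul]
  rw [Finset.sum_comm]
  simp only [MonoidAlgebra.coeff_sum, MonoidAlgebra.coeff_single, Finsupp.coe_finsetSum,
    Finset.sum_apply, hsum]
  rw [← Finset.sum_mul, ← Finset.card_smul_expect, smul_mul_assoc]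
  rfl

variable {H : Type v} [NormedAddCommGroup H] [InnerProductSpace ℂ H] [CompleteSpace H]
  (π : G →* (H ≃ₗᵢ[ℂ] H))

theorem card_smul_integrate_pointwiseMul_cutoff (X U : Finset G) (f : ℂ[G]) (ξ : H) :
    U.card • integrate π (pointwiseMul (cutoff X U) f) ξ =
      ∑ x : X, π x (∑ u : U, lconvBlock f X U x u • π (u : G)⁻¹ ξ) := by
  rw [← smul_apply, ← map_nsmul, card_smul_pointwiseMul_cutoff, ← Finset.sum_coe_sort X]
  simp_rw [← Finset.sum_coe_sort U, map_sum, map_smul, sum_apply, integrate_single, map_mul]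
  rfl

theorem norm_integrate_pointwiseMul_cutoff_le [DecidableEq G] (hU : U.Nonempty) (f : ℂ[G]) :
    ‖integrate π (pointwiseMul (cutoff X U) f)‖ ≤
      √(X.card / U.card) * ‖lconvBlock f X U‖ := by
  have hcard : (0 : ℝ) < U.card := by exact_mod_cast hU.card_pos
  refine ContinuousLinearMap.opNorm_le_bound _ (by positivity) fun ξ => ?_
  refine le_of_sq_le_sq ?_ (by positivity)
  let w (x : X) : H := ∑ u : U, lconvBlock f X U x u • π (u : G)⁻¹ ξ
  have hw : ∑ x, ‖w x‖ ^ 2 ≤ ‖lconvBlock f X U‖ ^ 2 * (U.card * ‖ξ‖ ^ 2) := by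
    refine (sum_norm_sum_smul_sq_le (lconvBlock f X U) fun u => π (u : G)⁻¹ ξ).trans_eq ?_
    simp only [LinearIsometryEquiv.norm_map, Finset.sum_const, Finset.card_univ, Fintype.card_coe,
      nsmul_eq_mul]
  have hsq : (U.card * ‖integrate π (pointwiseMul (cutoff X U) f) ξ‖) ^ 2 ≤
      X.card * (‖lconvBlock f X U‖ ^ 2 * (U.card * ‖ξ‖ ^ 2)) :=
    calc (U.card * ‖integrate π (pointwiseMul (cutoff X U) f) ξ‖) ^ 2
        = ‖∑ x : X, π x (w x)‖ ^ 2 := by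
          rw [← card_smul_integrate_pointwiseMul_cutoff, RCLike.norm_nsmul ℂ, nsmul_eq_mul]
      _ ≤ (∑ x : X, ‖w x‖) ^ 2 := by
          gcongr
          exact norm_sum_le_of_le _ fun x _ => ((π x).norm_map (w x)).le
      _ ≤ X.card * ∑ x : X, ‖w x‖ ^ 2 := by
          simpa only [Finset.card_univ, Fintype.card_coe] using
            sq_sum_le_card_mul_sum_sq (s := .univ) (f := fun x : X => ‖w x‖)
      _ ≤ _ := by gcongr
  rw [mul_pow, mul_pow, Real.sq_sqrt (by positivity)]
  rw [mul_pow] at hsq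
  refine le_of_mul_le_mul_left (hsq.trans_eq ?_) (pow_pos hcard 2)
  field_simp

end Transference

/-! ### Localization under bounded doubling -/

section Doubling

variable {G : Type u} [Group G] {𝕃 : LengthFunction G}

/-- The closed ball `B(r)` of a proper length function, as a finset. -/
def LengthFunction.IsProper.finball (hp : 𝕃.IsProper) (r : ℝ) : Finset G := (hp r).toFinset

namespace LengthFunction.IsProper

variable (hp : 𝕃.IsProper) {r : ℝ}

@[simp]
theorem mem_finball {x : G} : x ∈ hp.finball r ↔ 𝕃 x ≤ r :=
  (hp r).mem_toFinset

theorem finball_nonempty (hr : 0 ≤ r) : (hp.finball r).Nonempty :=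
  ⟨1, hp.mem_finball.2 (𝕃.map_one.trans_le hr)⟩

end LengthFunction.IsProper

theorem LengthFunction.BoundedDoubling.exists_sqrt_card_finball_le (h : 𝕃.BoundedDoubling) :
    ∃ C : ℝ, 0 ≤ C ∧ ∀ (k : ℕ) (r : ℝ), 1 ≤ r →
      √((h.1.finball (4 ^ k * r)).card / (h.1.finball r).card) ≤ C ^ k := by
  obtain ⟨C₀, hC₀⟩ := h.2
  let C := max C₀ 0
  have hC0 : 0 ≤ C := le_max_right _ _
  have hdouble (r : ℝ) (hr : 1 ≤ r) :
      ((h.1.finball (2 * r)).card : ℝ) ≤ C * (h.1.finball r).card := by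
    have h₀ := hC₀ r hr
    rw [Set.ncard_eq_toFinset_card _ (h.1 _), Set.ncard_eq_toFinset_card _ (h.1 _)] at h₀
    exact h₀.trans (mul_le_mul_of_nonneg_right (le_max_left _ _) (Nat.cast_nonneg _))
  refine ⟨C, hC0, fun k r hr => ?_⟩
  have hcard : (0 : ℝ) < (h.1.finball r).card :=
    mod_cast (h.1.finball_nonempty (zero_le_one.trans hr)).card_pos
  rw [Real.sqrt_le_left (pow_nonneg hC0 k), div_le_iff₀ hcard]
  induction k with
  | zero => simp
  | succ k ih =>
    have hk : 1 ≤ 4 ^ k * r := one_le_mul_of_one_le_of_one_le (one_le_pow₀ (by norm_num)) hr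
    calc ((h.1.finball (4 ^ (k + 1) * r)).card : ℝ)
        = (h.1.finball (2 * (2 * (4 ^ k * r)))).card := by congr 3; ring
      _ ≤ C * (h.1.finball (2 * (4 ^ k * r))).card := hdouble _ (by linarith)
      _ ≤ C * (C * (h.1.finball (4 ^ k * r)).card) := by gcongr; exact hdouble _ hk
      _ ≤ C * (C * ((C ^ k) ^ 2 * (h.1.finball r).card)) := by gcongr
      _ = (C ^ (k + 1)) ^ 2 * (h.1.finball r).card := by ring

section Cutoffs

variable (hp : 𝕃.IsProper) {R : ℝ}

/-- The elements of length in `(2R, 16R]`. -/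
def annulus (R : ℝ) : Finset G := {x ∈ hp.finball (4 ^ 2 * R) | 2 * R < 𝕃 x}

/-- A cutoff function equal to `1` where `3R < 𝕃 ≤ 15R`. -/
def annulusCutoff (R : ℝ) : G → ℂ := cutoff (annulus hp R) (hp.finball R)

/-- A cutoff function equal to `1` where `𝕃 ≤ 3R` and to `0` where `𝕃 > 5R`. -/
def ballCutoff (R : ℝ) : G → ℂ := cutoff (hp.finball (4 * R)) (hp.finball R)

theorem annulusCutoff_eq_one (hR : 0 ≤ R) {z : G} (h₁ : 3 * R < 𝕃 z) (h₂ : 𝕃 z ≤ 15 * R) :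
    annulusCutoff hp R z = 1 := by
  refine cutoff_eq_one (hp.finball_nonempty hR) fun u hu => ?_
  rw [hp.mem_finball] at hu
  rw [annulus, Finset.mem_filter, hp.mem_finball]
  constructor <;> linarith [𝕃.mul_le' z u, 𝕃.le_map_mul_add z u]

theorem ballCutoff_eq_one (hR : 0 ≤ R) {z : G} (h : 𝕃 z ≤ 3 * R) : ballCutoff hp R z = 1 := by
  refine cutoff_eq_one (hp.finball_nonempty hR) fun u hu => ?_
  rw [hp.mem_finball] at hu ⊢
  linarith [𝕃.mul_le' z u]

theorem ballCutoff_eq_zero {z : G} (h : 5 * R < 𝕃 z) : ballCutoff hp R z = 0 := by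
  refine cutoff_eq_zero fun u hu => ?_
  rw [hp.mem_finball] at hu ⊢
  linarith [𝕃.le_map_mul_add z u]

theorem ballCutoff_two_mul_sub_mul_annulusCutoff (hR : 0 ≤ R) (z : G) :
    (ballCutoff hp (2 * R) z - ballCutoff hp R z) * annulusCutoff hp R z =
      ballCutoff hp (2 * R) z - ballCutoff hp R z := by
  rcases le_or_gt (𝕃 z) (3 * R) with h₁ | h₁
  · rw [ballCutoff_eq_one hp hR h₁, ballCutoff_eq_one hp (by linarith) (by linarith), sub_self,
      zero_mul]
  rcases le_or_gt (𝕃 z) (15 * R) with h₂ | h₂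
  · rw [annulusCutoff_eq_one hp hR h₁ h₂, mul_one]
  · rw [ballCutoff_eq_zero hp (by linarith), ballCutoff_eq_zero hp (by linarith), sub_self,
      zero_mul]

theorem eventually_pointwiseMul_ballCutoff_two_pow (f : ℂ[G]) :
    ∀ᶠ n : ℕ in atTop, pointwiseMul (ballCutoff hp (2 ^ n)) f = f := by
  obtain ⟨M, hM⟩ := (f.coeff.support.finite_toSet.image 𝕃).bddAbove
  filter_upwards [(tendsto_pow_atTop_atTop_of_one_lt one_lt_two).eventually_ge_atTop M] with n hn
  refine pointwiseMul_eq_self fun z hz => ballCutoff_eq_one hp (by positivity) ?_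
  have hzM : 𝕃 z ≤ M := hM ⟨z, Finsupp.mem_support_iff.2 hz, rfl⟩
  linarith [pow_pos (two_pos : (0 : ℝ) < 2) n]

theorem norm_lconv_annulusCutoff_le (hR : 0 < R) (f : ℂ[G]) :
    ‖lconv (pointwiseMul (annulusCutoff hp R) f)‖ ≤
      √((hp.finball (4 ^ 2 * R)).card / (hp.finball R).card) * (seminormLD 𝕃 f / R) := by
  classical
  have hblock : ‖lconvBlock f (annulus hp R) (hp.finball R)‖ ≤ seminormLD 𝕃 f / R := by
    rw [le_div_iff₀' hR]
    simpa only [two_mul, add_sub_cancel_right] using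
      sub_mul_norm_lconvBlock_le f (annulus hp R) (hp.finball R) 𝕃 (by positivity : 0 < 2 * R)
        (fun x hx => (Finset.mem_filter.1 hx).2.le) hR.le fun u hu => hp.mem_finball.1 hu
  calc ‖lconv (pointwiseMul (annulusCutoff hp R) f)‖
      ≤ √((annulus hp R).card / (hp.finball R).card) *
          ‖lconvBlock f (annulus hp R) (hp.finball R)‖ :=
        norm_integrate_pointwiseMul_cutoff_le _ (hp.finball_nonempty hR.le) f
    _ ≤ _ := by
        gcongr
        exact Finset.filter_subset _ _

variable {H : Type v} [NormedAddCommGroup H] [InnerProductSpace ℂ H] [CompleteSpace H]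
  (π : G →* (H ≃ₗᵢ[ℂ] H))

theorem norm_integrate_ballCutoff_le (hR : 0 ≤ R) (f : ℂ[G]) :
    ‖integrate π (pointwiseMul (ballCutoff hp R) f)‖ ≤
      √((hp.finball (4 * R)).card / (hp.finball R).card) * ‖lconv f‖ := by
  classical
  refine (norm_integrate_pointwiseMul_cutoff_le π (hp.finball_nonempty hR) f).trans ?_
  gcongr
  exact norm_lconvBlock_le f _ _

theorem norm_integrate_ballCutoff_two_mul_sub_le {C : ℝ}
    (hC : ∀ (k : ℕ) (r : ℝ), 1 ≤ r →
      √((hp.finball (4 ^ k * r)).card / (hp.finball r).card) ≤ C ^ k) (hR : 1 ≤ R) (f : ℂ[G]) :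
    ‖integrate π (pointwiseMul (ballCutoff hp (2 * R)) f) -
        integrate π (pointwiseMul (ballCutoff hp R) f)‖ ≤ 2 * C ^ 3 * seminormLD 𝕃 f / R := by
  have hR0 : 0 < R := zero_lt_one.trans_le hR
  let g := pointwiseMul (annulusCutoff hp R) f
  have hg : pointwiseMul (ballCutoff hp (2 * R)) f - pointwiseMul (ballCutoff hp R) f =
      pointwiseMul (ballCutoff hp (2 * R)) g - pointwiseMul (ballCutoff hp R) g := by
    ext z
    simp only [g, MonoidAlgebra.coeff_sub, Finsupp.sub_apply, coeff_pointwiseMul, ← sub_mul,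
      ← mul_assoc, ballCutoff_two_mul_sub_mul_annulusCutoff hp hR0.le]
  have hC1 (r : ℝ) (hr : 1 ≤ r) :
      √((hp.finball (4 * r)).card / (hp.finball r).card) ≤ C := by
    simpa only [pow_one] using hC 1 r hr
  have hC0 : 0 ≤ C := (Real.sqrt_nonneg _).trans (hC1 1 le_rfl)
  have hball (r : ℝ) (hr : 1 ≤ r) :
      ‖integrate π (pointwiseMul (ballCutoff hp r) g)‖ ≤ C * (C ^ 2 * (seminormLD 𝕃 f / R)) := by
    refine (norm_integrate_ballCutoff_le hp π (zero_le_one.trans hr) g).trans ?_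
    gcongr
    · exact hC1 r hr
    · exact (norm_lconv_annulusCutoff_le hp hR0 f).trans (by gcongr; exact hC 2 R hR)
  rw [← map_sub, hg, map_sub]
  refine (norm_sub_le_of_le (hball _ (by linarith)) (hball R hR)).trans_eq ?_
  ring

end Cutoffs

theorem exists_norm_integrate_sub_ballCutoff_le (h : 𝕃.BoundedDoubling) :
    ∃ K : ℝ, 0 ≤ K ∧ ∀ {H : Type v} [NormedAddCommGroup H] [InnerProductSpace ℂ H]
      [CompleteSpace H] (π : G →* (H ≃ₗᵢ[ℂ] H)) (f : ℂ[G]) (n : ℕ),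
      ‖integrate π (pointwiseMul (ballCutoff h.1 (2 ^ n)) f) - integrate π f‖ ≤
        K * seminormLD 𝕃 f / 2 ^ n := by
  obtain ⟨C, hC0, hC⟩ := h.exists_sqrt_card_finball_le
  refine ⟨4 * C ^ 3, by positivity, fun π f n => ?_⟩
  rw [← dist_eq_norm]
  refine dist_le_of_le_geometric_two_of_tendsto (fun k => ?_)
    (f := fun k => integrate π (pointwiseMul (ballCutoff h.1 (2 ^ k)) f))
    (tendsto_const_nhds.congr' ?_) n
  · rw [dist_comm, dist_eq_norm, pow_succ']
    refine (norm_integrate_ballCutoff_two_mul_sub_le h.1 π hC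
      (one_le_pow₀ one_le_two) f).trans_eq ?_
    ring
  · filter_upwards [eventually_pointwiseMul_ballCutoff_two_pow h.1 f] with k hk
    rw [hk]

end Doubling

/-! ### The Lip-norm property -/

section TotallyBounded

theorem totallyBounded_of_approx {α : Type*} [PseudoMetricSpace α] {s : Set α}
    (h : ∀ ε > 0, ∃ t, TotallyBounded t ∧ ∀ x ∈ s, ∃ y ∈ t, dist x y < ε) : TotallyBounded s := by
  refine Metric.totallyBounded_iff.2 fun ε hε => ?_
  obtain ⟨t, ht, hst⟩ := h (ε / 2) (half_pos hε)
  obtain ⟨c, hc, htc⟩ := Metric.totallyBounded_iff.1 ht (ε / 2) (half_pos hε)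
  refine ⟨c, hc, fun x hx => ?_⟩
  obtain ⟨y, hy, hxy⟩ := hst x hx
  obtain ⟨z, hz, hyz⟩ := Set.mem_iUnion₂.1 (htc hy)
  refine Set.mem_iUnion₂.2 ⟨z, hz, Metric.mem_ball.2 ?_⟩
  linarith [dist_triangle x y z, Metric.mem_ball.1 hyz]

theorem totallyBounded_image_of_coeff_bound {G E : Type*} [AddCommGroup E] [Module ℂ E]
    [UniformSpace E] [ContinuousAdd E] [ContinuousSMul ℂ E] (j : ℂ[G] →ₗ[ℂ] E) (S : Finset G)
    (M : G → ℝ) :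
    TotallyBounded (j '' {f | ∀ z, (f.coeff z ≠ 0 → z ∈ S) ∧ ‖f.coeff z‖ ≤ M z}) := by
  let combine (c : G → ℂ) : E := ∑ z ∈ S, c z • j (.single z 1)
  have hcombine : Continuous combine := by fun_prop
  have hcompact : IsCompact (Set.univ.pi fun z => Metric.closedBall (0 : ℂ) (M z)) :=
    isCompact_univ_pi fun z => isCompact_closedBall _ _
  refine (hcompact.image hcombine).totallyBounded.subset ?_
  rintro _ ⟨f, hf, rfl⟩
  refine ⟨f.coeff, fun z _ => mem_closedBall_zero_iff.2 (hf z).2, ?_⟩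
  conv_rhs => rw [eq_sum_single fun z => (hf z).1]
  simp only [combine, map_sum, ← map_smul, MonoidAlgebra.smul_single, smul_eq_mul, mul_one]

end TotallyBounded

section LipNorm

variable {G : Type u} [Group G] {𝕃 : LengthFunction G}

theorem norm_coeff_le_inv_length {f : ℂ[G]} (hf : seminormLD 𝕃 f ≤ 1) (hf1 : f.coeff 1 = 0)
    (z : G) : ‖f.coeff z‖ ≤ (𝕃 z)⁻¹ := by
  rcases eq_or_ne z 1 with rfl | hz
  · rw [hf1, norm_zero]
    exact inv_nonneg.2 (𝕃.nonneg' 1)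
  · have hpos : 0 < 𝕃 z := (𝕃.nonneg' z).lt_of_ne' (mt (𝕃.eq_zero_iff' z).1 hz)
    rw [← one_div, le_div_iff₀' hpos]
    exact (length_mul_norm_coeff_le 𝕃 f z).trans hf

variable {H : Type v} [NormedAddCommGroup H] [InnerProductSpace ℂ H] [CompleteSpace H]
  (π : G →* (H ≃ₗᵢ[ℂ] H))

theorem denseRange_toCstarOf : DenseRange (toCstarOf π) := fun a => by
  rw [IsInducing.subtypeVal.closure_eq_preimage_closure_image, ← Set.range_comp]
  exact a.2

theorem totallyBounded_image_seminormLD_le_one (h : 𝕃.BoundedDoubling) :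
    TotallyBounded (toCstarOf π '' {f | seminormLD 𝕃 f ≤ 1 ∧ f.coeff 1 = 0}) := by
  refine totallyBounded_of_approx fun ε hε => ?_
  obtain ⟨K, hK0, hK⟩ := exists_norm_integrate_sub_ballCutoff_le.{u, v} h
  obtain ⟨n, hn⟩ : ∃ n : ℕ, K / 2 ^ n < ε :=
    ((tendsto_const_nhds.div_atTop
      (tendsto_pow_atTop_atTop_of_one_lt one_lt_two)).eventually_lt_const hε).exists
  let φ := ballCutoff h.1 (2 ^ n)
  refine ⟨_, totallyBounded_image_of_coeff_bound (toCstarOf π).toAlgHom.toLinearMap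
    (h.1.finball (5 * 2 ^ n)) (fun z => ‖φ z‖ * (𝕃 z)⁻¹), ?_⟩
  rintro _ ⟨f, ⟨hf, hf1⟩, rfl⟩
  refine ⟨_, ⟨pointwiseMul φ f, fun z => ⟨fun hz => ?_, ?_⟩, rfl⟩, ?_⟩
  · refine h.1.mem_finball.2 (le_of_not_gt fun hlt => left_ne_zero_of_mul hz ?_)
    exact ballCutoff_eq_zero h.1 hlt
  · rw [coeff_pointwiseMul, norm_mul]
    gcongr
    exact norm_coeff_le_inv_length hf hf1 z
  · rw [dist_comm, dist_eq_norm]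
    refine (hK π f n).trans_lt (lt_of_le_of_lt ?_ hn)
    gcongr
    exact mul_le_of_le_one_right hK0 hf

theorem sub_algebraMap_coeff_one_mem {f : ℂ[G]} (hf : seminormLD 𝕃 f ≤ 1) :
    f - algebraMap ℂ ℂ[G] (f.coeff 1) ∈ {f | seminormLD 𝕃 f ≤ 1 ∧ f.coeff 1 = 0} := by
  have hscalar (c : ℂ) : seminormLD 𝕃 (algebraMap ℂ ℂ[G] c) = 0 := by
    rw [Algebra.algebraMap_eq_smul_one, map_smul_eq_mul, seminormLD_one, mul_zero]
  refine ⟨(map_sub_le_add _ _ _).trans (by rwa [hscalar, add_zero]), ?_⟩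
  simp

variable (G) in
theorem injective_lconv : Function.Injective (lconv : ℂ[G] → _) := fun f g hfg => by
  ext z
  simpa only [inner_deltaBasis_lconv, inv_one, mul_one] using
    congrArg (fun T => inner ℂ (deltaBasis G z) (T (deltaBasis G 1))) hfg

theorem integrate_universalRep_apply (f : ℂ[G]) (η : UniversalSpace G) (σ : UnitaryRep.{u} G) :
    integrate (universalRep G) f η σ = integrate σ.rep f (η σ) := by
  induction f using MonoidAlgebra.induction_linear with
  | zero => simp only [map_zero, zero_apply, lp.coeFn_zero, Pi.zero_apply]
  | add f g hf hg => simp only [map_add, add_apply, lp.coeFn_add, Pi.add_apply, hf, hg]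
  | single z c =>
    rw [integrate_single, integrate_single, lp.coeFn_smul, Pi.smul_apply]
    rfl

variable (G) in
theorem injective_integrate_universalRep :
    Function.Injective (integrate (universalRep G)) := fun f g hfg => by
  classical
  let σ : UnitaryRep G := ⟨Ell2 G, leftRegular G⟩
  have hσ (f : ℂ[G]) (ξ : Ell2 G) :
      integrate (universalRep G) f (lp.single 2 σ ξ) σ = lconv f ξ := by
    rw [integrate_universalRep_apply, lp.single_apply_self]
  refine injective_lconv G (ContinuousLinearMap.ext fun ξ => ?_)
  rw [← hσ, ← hσ, hfg]

end LipNorm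

end GroupCStar

end

theorem theorem1p4_general {G H : Type*} [Group G] [NormedAddCommGroup H] [InnerProductSpace ℂ H]
    [CompleteSpace H] (𝕃 : GroupCStar.LengthFunction G) (h𝕃 : 𝕃.BoundedDoubling)
    (π : G →* (H ≃ₗᵢ[ℂ] H)) (hπ : Function.Injective (GroupCStar.integrate π)) :
    GroupCStar.IsLipNorm (GroupCStar.toCstarOf π) (GroupCStar.seminormLD 𝕃) where
  injective _ _ hfg := hπ (congrArg Subtype.val hfg)
  denseRange := GroupCStar.denseRange_toCstarOf π
  map_star := GroupCStar.seminormLD_star 𝕃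
  map_one := GroupCStar.seminormLD_one 𝕃
  topology_eq := GroupCStar.connesMetric_topology_eq (GroupCStar.denseRange_toCstarOf π)
    (GroupCStar.totallyBounded_image_seminormLD_le_one π h𝕃)
    fun _ hf => ⟨_, GroupCStar.sub_algebraMap_coeff_one_mem hf⟩

theorem theorem1p4 {G : Type*} [Group G] (𝕃 : GroupCStar.LengthFunction G)
    (h𝕃 : 𝕃.BoundedDoubling) :
    GroupCStar.IsLipNorm
        (GroupCStar.toCstarOf (GroupCStar.leftRegular G) : _ →⋆ₐ[ℂ] GroupCStar.ReducedCStar G)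
        (GroupCStar.seminormLD 𝕃) ∧
      GroupCStar.IsLipNorm
        (GroupCStar.toCstarOf (GroupCStar.universalRep G) : _ →⋆ₐ[ℂ] GroupCStar.FullCStar G)
        (GroupCStar.seminormLD 𝕃) :=
  ⟨theorem1p4_general 𝕃 h𝕃 _ (GroupCStar.injective_lconv G),
    theorem1p4_general 𝕃 h𝕃 _ (GroupCStar.injective_integrate_universalRep G)⟩
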